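/- Let $a$ be a positive integer, let $h$ be a positive divisor of $a$, let $p$ be a prime dividing $a/h$, let $\varepsilon>0$, and put $R=\mathbb Z/a\mathbb Z$. A random variable $N$ with values in $R$ is called $\varepsilon$-balanced if $\mathbb P[N\equiv r \pmod{\mathfrak p}]\le 1-\varepsilon$ for every maximal ideal $\mathfrak p$ of $R$ and every residue class $r\in R/\mathfrak p$. For each natural number $n$, let $C_n$ be a deterministic alternating $n\times n$ matrix over $R$ (that is, $C_n^{\mathsf T}=-C_n$ and $C_n$ has zero diagonal) all of whose entries are divisible by $h$, and let $X_n$ be a random $n\times n$ matrix over $R$ with $X_n-X_n^{\mathsf T}=C_n$ almost surely, whose entries on and above the diagonal are independent and $\varepsilon$-balanced. For a finite abelian group $G$ let $\#\operatorname{Sur}(\operatorname{coker}X_n,G)$ be the number of surjective homomorphisms from $\operatorname{coker}(X_n)=R^n/X_nR^n$ onto $G$, and let $G[h]$ be the subgroup of elements of $G$ of order dividing $h$. The matrix $C_n/h$ is well defined modulo $a/h$, hence modulo $p$. Suppose that the rank over $\mathbb F_p$ of $C_n/h \bmod p$ is bounded as $n$ varies. Then $$\liminf_{n\to\infty}\ \mathbb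 E\big[\#\operatorname{Sur}(\operatorname{coker}(X_n),(\mathbb Z/hp\mathbb Z)^2)\big] \;>\; \big|\wedge^2\big((\mathbb Z/hp\mathbb Z)^2[h]\big)\big| .$$ In particular, it is not the case that $\lim_{n\to\infty}\mathbb E[\#\operatorname{Sur}(\operatorname{coker}(X_n),G)]=|\wedge^2 (G[h])|$ for every finite abelian group $G$ of exponent dividing $a$; for $h=1$, these are the Cohen--Lenstra moments $|\wedge^2(G[1])|=1$. -/

import Mathlib

open MeasureTheory ProbabilityTheory Filter Topology
open scoped ENNReal Matrix

noncomputable section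

/-- `C` is an alternating matrix: skew-symmetric with zero diagonal. -/
def IsAlternatingMatrix {R : Type*} [CommRing R] {n : ℕ} (C : Matrix (Fin n) (Fin n) R) : Prop :=
  Cᵀ = -C ∧ ∀ i, C i i = 0

/-- `X` is `C`-symmetric: `X - Xᵀ = C`. -/
def IsCSymmetric {R : Type*} [CommRing R] {n : ℕ} (C X : Matrix (Fin n) (Fin n) R) : Prop :=
  X - Xᵀ = C

/-- A random variable `N` with values in a ring `R` is `ε`-balanced under `μ`: for every maximal
ideal `P` of `R` and every residue class `r` modulo `P`, `ℙ[N ≡ r mod P] ≤ 1 - ε`. -/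
def IsBalanced {R : Type*} [CommRing R] {Ω : Type*} [MeasurableSpace Ω]
    (μ : Measure Ω) (ε : ℝ) (N : Ω → R) : Prop :=
  ∀ P : Ideal R, P.IsMaximal → ∀ r : R ⧸ P,
    μ.real {ω | Ideal.Quotient.mk P (N ω) = r} ≤ 1 - ε

/-- `X` is a random `C`-symmetric `n × n` matrix over `ℤ/aℤ` whose entries on and above the
diagonal are independent and `ε`-balanced. -/
structure IsBalancedCSymmetric {a n : ℕ} {Ω : Type*} [MeasurableSpace Ω] (μ : Measure Ω)
    (ε : ℝ) (C : Matrix (Fin n) (Fin n) (ZMod a)) (X : Ω → Matrix (Fin n) (Fin n) (ZMod a)) :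
    Prop where
  measurable : ∀ i j, Measurable fun ω => X ω i j
  symmetric : ∀ᵐ ω ∂μ, IsCSymmetric C (X ω)
  indep : iIndepFun (fun (q : {q : Fin n × Fin n // q.1 ≤ q.2}) ω => X ω q.1.1 q.1.2) μ
  balanced : ∀ i j, i ≤ j → IsBalanced μ ε fun ω => X ω i j

/-- The cokernel `Rⁿ / M Rⁿ` of a square matrix. -/
abbrev MatrixCoker {R : Type*} [CommRing R] {n : ℕ} (M : Matrix (Fin n) (Fin n) R) : Type _ :=
  (Fin n → R) ⧸ LinearMap.range M.mulVecLin

/-- `# Sur(A, G)`, the number of surjective homomorphisms of abelian groups from `A` onto `G`. -/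
def numSur (A G : Type*) [AddCommGroup A] [AddCommGroup G] : ℕ :=
  Nat.card {f : A →+ G // Function.Surjective f}

/-- The `G`-moment `𝔼[# Sur(coker X, G)]` of the cokernel of a random matrix `X`, as the integral
of a nonnegative function. -/
def cokerMoment {R : Type*} [CommRing R] {n : ℕ} {Ω : Type*} [MeasurableSpace Ω]
    (μ : Measure Ω) (X : Ω → Matrix (Fin n) (Fin n) R) (G : Type*) [AddCommGroup G] : ℝ≥0∞ :=
  ∫⁻ ω, (numSur (MatrixCoker (X ω)) G : ℝ≥0∞) ∂μ

/-- `|∧² (G[h])|`, where `G[h]` is the subgroup of elements of order dividing `h`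
and the exterior square is taken over `ℤ`. -/
def cardWedgeTwoTorsion (G : Type*) [AddCommGroup G] (h : ℕ) : ℕ :=
  Nat.card (⋀[ℤ]^2 (Submodule.torsionBy ℤ G (h : ℤ)))

/-- For a matrix `C` over `ℤ/aℤ` all of whose entries are divisible by `h`, where `h ∣ a` and
`p ∣ a / h`, the matrix `C / h mod p`. (The matrix `C / h` is well defined modulo `a / h`, hence
modulo `p`; it is computed from the representatives of the entries of `C` in `{0, …, a - 1}`.) -/
def divModMatrix {a n : ℕ} (h p : ℕ) (C : Matrix (Fin n) (Fin n) (ZMod a)) :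
    Matrix (Fin n) (Fin n) (ZMod p) :=
  C.map fun c => ((c.val / h : ℕ) : ZMod p)

/-- `divModMatrix` does not depend on choices: if `C = h D`, then `C / h mod p` is `D mod p`. -/
theorem divModMatrix_nsmul {a n h p : ℕ} [NeZero a] (hha : h ∣ a) (hpa : p ∣ a / h)
    (D : Matrix (Fin n) (Fin n) (ZMod a)) :
    divModMatrix h p (h • D) =
      D.map (ZMod.castHom (hpa.trans (Nat.div_dvd_of_dvd hha)) (ZMod p)) := by
  obtain ⟨b, rfl⟩ := hha
  have hne : h * b ≠ 0 := NeZero.ne _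
  have hh : 0 < h := Nat.pos_of_ne_zero fun h0 => hne (by simp [h0])
  rw [Nat.mul_div_cancel_left b hh] at hpa
  ext i j
  simp only [divModMatrix, Matrix.map_apply, Matrix.smul_apply, ZMod.castHom_apply]
  rw [nsmul_eq_mul]
  have hv : ((h : ZMod (h * b)) * D i j).val = h * ((D i j).val % b) := by
    conv_lhs => rw [← ZMod.natCast_zmod_val (D i j), ← Nat.cast_mul, ZMod.val_natCast]
    exact Nat.mul_mod_mul_left _ _ _
  rw [hv, Nat.mul_div_cancel_left _ hh, ZMod.cast_eq_val]
  exact (ZMod.natCast_eq_natCast_iff _ _ _).2 ((Nat.mod_modEq _ _).of_dvd hpa)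

end

/-! Put m = hp. A tuple F of n vectors in (ℤ/m)² that takes every value and is annihilated by X
gives a surjection from the cokernel, and distinct tuples give distinct surjections. By Fourier
inversion, m^(2n) times the probability that X annihilates F is the sum over H of 𝔼 χ(∑ X i j (F i
⬝ᵥ H j)). The m tuples H = c • rot F are special. Since g ⬝ᵥ rot g' is alternating, the random
entries cancel and only a phase remains, given by c times the value at F of the bilinear form of C.
If this value is 0, each special H contributes 1 (`integral_stdAddChar_smul_rot`). For a typical F
all other H together contribute o(1) (`crossSupport_dichotomy`, `sum_pow_crossSupport_le`), so F is
annihilated with probability at least (m - o(1)) / m^(2n) (`le_card_mul_measureReal`). The form of C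
vanishes mod hp as soon as that of C/h vanishes mod p. When the rank of C/h is at most B, this form
is biased towards 0: its zeros have density at least (1 + (p-1)/p^B)/p (`card_bilinear_zero_ge`).
Hence the moments are asymptotically at least h(1 + (p-1)/p^B) > h, while the exterior square of
G[h] has at most h elements (`cardWedgeTwoTorsion_le`). -/

/-! ### Fourier coefficients of balanced variables -/

theorem exists_re_stdAddChar_le (m : ℕ) [NeZero m] :
    ∃ κ : ℝ, 0 < κ ∧ ∀ s : ZMod m, s ≠ 0 → (ZMod.stdAddChar s : ℂ).re ≤ 1 - κ := by
  have key : ∀ s : ZMod m, s ≠ 0 → (ZMod.stdAddChar s : ℂ).re < 1 := by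
    intro s hs
    have hn : ‖(ZMod.stdAddChar s : ℂ)‖ = 1 := AddChar.norm_apply _ _
    refine lt_of_le_of_ne (hn ▸ Complex.re_le_norm _) fun h1 => hs ?_
    apply ZMod.injective_stdAddChar (N := m)
    rw [AddChar.map_zero_eq_one]
    have h2 := Complex.sq_norm (ZMod.stdAddChar s : ℂ)
    rw [hn, Complex.normSq_apply, h1] at h2
    apply Complex.ext
    · simpa using h1
    · simp only [Complex.one_im]; nlinarith
  by_cases hne : (Finset.univ.filter fun s : ZMod m => s ≠ 0).Nonempty
  · obtain ⟨s₀, hs₀, hmax⟩ := Finset.exists_max_image _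
      (fun s : ZMod m => (ZMod.stdAddChar s : ℂ).re) hne
    refine ⟨1 - (ZMod.stdAddChar s₀ : ℂ).re, by
      have := key s₀ (Finset.mem_filter.1 hs₀).2; linarith, fun s hs => ?_⟩
    have := hmax s (by simp [hs])
    linarith
  · refine ⟨1, one_pos, fun s hs => (hne ⟨s, by simp [hs]⟩).elim⟩

/-- A probability vector on `ZMod m` without large atoms has a small Fourier coefficient. -/
theorem norm_sq_sum_stdAddChar_le {m : ℕ} [NeZero m] {κ ε : ℝ} (hκ0 : 0 ≤ κ)
    (hκ : ∀ s : ZMod m, s ≠ 0 → (ZMod.stdAddChar s : ℂ).re ≤ 1 - κ)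
    (q : ZMod m → ℝ) (hq : ∀ s, 0 ≤ q s) (hsum : ∑ s, q s = 1) (hle : ∀ s, q s ≤ 1 - ε) :
    ‖∑ s, (q s : ℂ) * ZMod.stdAddChar s‖ ^ 2 ≤ 1 - κ * ε := by
  have h1 : ‖∑ s, (q s : ℂ) * ZMod.stdAddChar s‖ ^ 2 =
      ∑ s, ∑ t, q s * q t * (ZMod.stdAddChar (s - t) : ℂ).re := by
    have : ((‖∑ s, (q s : ℂ) * ZMod.stdAddChar s‖ ^ 2 : ℝ) : ℂ) =
        ∑ s, ∑ t, (q s : ℂ) * q t * (ZMod.stdAddChar (s - t) : ℂ) := by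
      rw [Complex.ofReal_pow, ← Complex.mul_conj', map_sum, Finset.sum_mul_sum]
      refine Finset.sum_congr rfl fun s _ => Finset.sum_congr rfl fun t _ => ?_
      rw [map_mul, Complex.conj_ofReal, ← AddChar.map_neg_eq_conj, sub_eq_add_neg,
        AddChar.map_add_eq_mul]
      ring
    have h := congrArg Complex.re this
    rw [Complex.ofReal_re] at h
    rw [h, Complex.re_sum]
    refine Finset.sum_congr rfl fun s _ => ?_
    rw [Complex.re_sum]
    refine Finset.sum_congr rfl fun t _ => ?_
    rw [← Complex.ofReal_mul, Complex.re_ofReal_mul]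
  rw [h1]
  -- Off-diagonal pairs gain the spectral gap κ; the diagonal loses it, but its weight ∑ q² is at
  -- most 1 - ε.
  have h2 : ∀ s t : ZMod m, q s * q t * (ZMod.stdAddChar (s - t) : ℂ).re ≤
      q s * q t * (1 - κ) + if s = t then κ * (q s * q s) else 0 := by
    intro s t
    split_ifs with hst
    · subst hst
      simp only [sub_self, AddChar.map_zero_eq_one, Complex.one_re]
      nlinarith
    · rw [add_zero]
      exact mul_le_mul_of_nonneg_left (hκ _ (sub_ne_zero.2 hst)) (mul_nonneg (hq s) (hq t))
  calc _ ≤ ∑ s, ∑ t, (q s * q t * (1 - κ) + if s = t then κ * (q s * q s) else 0) :=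
        Finset.sum_le_sum fun s _ => Finset.sum_le_sum fun t _ => h2 s t
    _ = (1 - κ) + κ * ∑ s, q s * q s := by
        simp only [Finset.sum_add_distrib, Finset.sum_ite_eq, Finset.mem_univ, if_true]
        rw [← Finset.mul_sum]
        congr 1
        simp only [← Finset.sum_mul, ← Finset.mul_sum, hsum, one_mul, mul_one]
    _ ≤ (1 - κ) + κ * ∑ s, q s * (1 - ε) := by
        gcongr with s
        · exact hq s
        · exact hle s
    _ = 1 - κ * ε := by rw [← Finset.sum_mul, hsum]; ring

/-- The elements x with x * t = 0 form a proper ideal, hence lie in some maximal P. Two values of N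
with the same product with t agree mod P, so no atom of N * t exceeds 1 - ε. -/
theorem IsBalanced.norm_integral_le {a m : ℕ} [NeZero a] [NeZero m] (hma : m ∣ a)
    {Ω : Type*} [MeasurableSpace Ω] {μ : Measure Ω} [IsProbabilityMeasure μ] {κ ε : ℝ}
    (hκ0 : 0 ≤ κ) (hκ : ∀ s : ZMod m, s ≠ 0 → (ZMod.stdAddChar s : ℂ).re ≤ 1 - κ)
    {N : Ω → ZMod a} (hN : Measurable N) (hbal : IsBalanced μ ε N) {t : ZMod m} (ht : t ≠ 0) :
    ‖∫ ω, (ZMod.stdAddChar (ZMod.castHom hma (ZMod m) (N ω) * t) : ℂ) ∂μ‖ ^ 2 ≤ 1 - κ * ε := by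
  set Y : Ω → ZMod m := fun ω => ZMod.castHom hma (ZMod m) (N ω) * t with hY
  have hYm : Measurable Y :=
    (measurable_from_top (f := fun x : ZMod a => ZMod.castHom hma (ZMod m) x * t)).comp hN
  have : IsProbabilityMeasure (μ.map Y) := Measure.isProbabilityMeasure_map hYm.aemeasurable
  have e1 : ∫ ω, (ZMod.stdAddChar (Y ω) : ℂ) ∂μ =
      ∑ s, ((μ.map Y).real {s} : ℂ) * ZMod.stdAddChar s := by
    rw [← integral_map (f := fun y => (ZMod.stdAddChar y : ℂ)) hYm.aemeasurable
      (measurable_from_top).aestronglyMeasurable,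
      integral_fintype (Integrable.of_finite)]
    simp [Complex.real_smul]
  rw [e1]
  refine norm_sq_sum_stdAddChar_le hκ0 hκ _ (fun s => measureReal_nonneg) ?_ fun s => ?_
  · simp
  · rw [map_measureReal_apply hYm (MeasurableSet.singleton s)]
    by_cases hne : ∃ ω₀, Y ω₀ = s
    · obtain ⟨ω₀, rfl⟩ := hne
      let J : Ideal (ZMod a) :=
        { carrier := {x | ZMod.castHom hma (ZMod m) x * t = 0}
          add_mem' := fun {x y} hx hy => by
            simp only [Set.mem_ofPred_eq, map_add, add_mul] at *; rw [hx, hy, add_zero]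
          zero_mem' := by simp
          smul_mem' := fun c x hx => by
            simp only [Set.mem_ofPred_eq, smul_eq_mul, map_mul, mul_assoc] at *
            rw [hx, mul_zero] }
      have hJ : J ≠ ⊤ := by
        rw [Ne, Ideal.eq_top_iff_one]
        intro h
        have : ZMod.castHom hma (ZMod m) 1 * t = 0 := h
        rw [map_one, one_mul] at this
        exact ht this
      obtain ⟨P, hP, hJP⟩ := Ideal.exists_le_maximal J hJ
      refine le_trans (measureReal_mono ?_) (hbal P hP (Ideal.Quotient.mk P (N ω₀)))
      intro ω hω
      simp only [Set.mem_preimage, Set.mem_singleton_iff] at hω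
      simp only [Set.mem_ofPred_eq]
      rw [Ideal.Quotient.eq]
      apply hJP
      change ZMod.castHom hma (ZMod m) (N ω - N ω₀) * t = 0
      rw [map_sub, sub_mul, sub_eq_zero]
      exact hω
    · have hemp : Y ⁻¹' {s} = ∅ := by
        ext ω
        simp only [Set.mem_preimage, Set.mem_singleton_iff, Set.mem_empty_iff_false, iff_false]
        exact fun h => hne ⟨ω, h⟩
      rw [hemp, measureReal_empty]
      -- For a value never attained, only 0 ≤ 1 - ε is needed; balancedness at any maximal ideal
      -- gives it.
      have : Nontrivial (ZMod a) := by
        refine ⟨0, 1, fun h => ht ?_⟩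
        have := congrArg (ZMod.castHom hma (ZMod m)) h
        rw [map_zero, map_one] at this
        rw [← one_mul t, ← this, zero_mul]
      obtain ⟨P, hP⟩ := Ideal.exists_maximal (ZMod a)
      exact measureReal_nonneg.trans (hbal P hP 0)

theorem exists_norm_integral_stdAddChar_le {a m : ℕ} [NeZero a] [NeZero m] (hma : m ∣ a) {ε : ℝ}
    (hε : 0 < ε) :
    ∃ ρ : ℝ, 0 < ρ ∧ ρ < 1 ∧ ∀ {Ω : Type*} [MeasurableSpace Ω] (μ : Measure Ω)
      [IsProbabilityMeasure μ] (N : Ω → ZMod a), Measurable N → IsBalanced μ ε N →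
      ∀ t : ZMod m, t ≠ 0 →
      ‖∫ ω, (ZMod.stdAddChar (ZMod.castHom hma (ZMod m) (N ω) * t) : ℂ) ∂μ‖ ≤ ρ := by
  obtain ⟨κ, hκ0, hκ⟩ := exists_re_stdAddChar_le m
  -- The floor 1/4 only keeps ρ positive, so that roots of it can be taken later.
  have hpos : 0 < max (1 - κ * ε) (1 / 4) := lt_max_of_lt_right (by norm_num)
  refine ⟨√(max (1 - κ * ε) (1 / 4)), Real.sqrt_pos.2 hpos, ?_, ?_⟩
  · rw [Real.sqrt_lt' one_pos, one_pow, max_lt_iff]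
    exact ⟨by nlinarith [mul_pos hκ0 hε], by norm_num⟩
  · intro Ω _ μ _ N hN hbal t ht
    exact Real.le_sqrt_of_sq_le ((hbal.norm_integral_le hma hκ0.le hκ hN ht).trans (le_max_left _ _))
-- The pairing of F and H, and the special characters
/-- The coefficient of the entry `(i, j)`, `i ≤ j`, of a `C`-symmetric matrix `X` in the sum
`∑ i j, X i j * (F i ⬝ᵥ H j)`. -/
def crossPairing {m n : ℕ} (F H : Fin n → Fin 2 → ZMod m) (i j : Fin n) : ZMod m :=
  if i = j then F i ⬝ᵥ H i else F i ⬝ᵥ H j + F j ⬝ᵥ H i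

/-- The number of positions on or above the diagonal at which `crossPairing F H` is nonzero. -/
def crossSupport {m n : ℕ} (F H : Fin n → Fin 2 → ZMod m) : ℕ :=
  (Finset.univ.filter fun q : {q : Fin n × Fin n // q.1 ≤ q.2} =>
    crossPairing F H q.1.1 q.1.2 ≠ 0).card

/-- Rotation by a right angle, `(x, y) ↦ (-y, x)`. -/
def rot {m : ℕ} (g : Fin 2 → ZMod m) : Fin 2 → ZMod m := ![-g 1, g 0]

/-- The functions `i ↦ c • rot (F i)`, which pair trivially with `F`. -/
def rotMultiples {m n : ℕ} [NeZero m] (F : Fin n → Fin 2 → ZMod m) :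
    Finset (Fin n → Fin 2 → ZMod m) :=
  Finset.univ.image fun (c : ZMod m) i => c • rot (F i)

theorem crossPairing_smul_rot {m n : ℕ} (F : Fin n → Fin 2 → ZMod m) (c : ZMod m) (i j : Fin n) :
    crossPairing F (fun i => c • rot (F i)) i j = 0 := by
  simp only [crossPairing, rot, dotProduct, Fin.sum_univ_two, Pi.smul_apply, smul_eq_mul,
    Matrix.cons_val_zero, Matrix.cons_val_one]
  split_ifs <;> ring

theorem card_rotMultiples {m n : ℕ} [NeZero m] {F : Fin n → Fin 2 → ZMod m}
    (hF : Function.Surjective F) : (rotMultiples F).card = m := by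
  rw [rotMultiples, Finset.card_image_of_injective, Finset.card_univ, ZMod.card]
  intro c d hcd
  -- Where F equals (1, 0), its rotation is (0, 1), whose second coordinate reveals the multiplier.
  obtain ⟨i, hi⟩ := hF ![1, 0]
  have := congrFun (congrFun hcd i) 1
  simpa [rot, hi] using this

theorem sum_sum_eq_sum_upper {M : Type*} [AddCommMonoid M] {n : ℕ} (f : Fin n → Fin n → M) :
    ∑ i, ∑ j, f i j = ∑ q : {q : Fin n × Fin n // q.1 ≤ q.2},
      if q.1.1 = q.1.2 then f q.1.1 q.1.1 else f q.1.1 q.1.2 + f q.1.2 q.1.1 := by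
  have h1 : ∀ i j, f i j = (if i ≤ j then f i j else 0) + if j < i then f i j else 0 := by
    intro i j
    rcases le_or_gt i j with h | h
    · simp [h, h.not_gt]
    · simp [h, h.not_ge]
  calc ∑ i, ∑ j, f i j
      = ∑ i, ∑ j, (if i ≤ j then f i j else 0) + ∑ i, ∑ j, (if j < i then f i j else 0) := by
        simp only [← Finset.sum_add_distrib, ← h1]
    _ = ∑ i, ∑ j, (if i ≤ j then f i j else 0) + ∑ i, ∑ j, (if i < j then f j i else 0) := by
        rw [Finset.sum_comm (f := fun i j => if j < i then f i j else 0)]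
    _ = ∑ i, ∑ j, if i ≤ j then (if i = j then f i i else f i j + f j i) else 0 := by
        simp only [← Finset.sum_add_distrib]
        refine Finset.sum_congr rfl fun i _ => Finset.sum_congr rfl fun j _ => ?_
        rcases lt_trichotomy i j with h | h | h
        · simp [h, h.le, h.ne]
        · simp [h]
        · simp [h.not_ge, h.not_gt]
    _ = _ := by
        rw [← Finset.sum_product', Finset.univ_product_univ, ← Finset.sum_filter]
        exact Finset.sum_subtype _ (by simp) _

/-- Substituting A j i = A i j - C i j below the diagonal leaves only the independent entries, at
the price of a deterministic term in C. -/
theorem sum_mul_dotProduct_of_isCSymmetric {m n : ℕ} {C A : Matrix (Fin n) (Fin n) (ZMod m)}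
    (hA : IsCSymmetric C A) (F H : Fin n → Fin 2 → ZMod m) :
    ∑ i, ∑ j, A i j * (F i ⬝ᵥ H j) =
      (-∑ q : {q : Fin n × Fin n // q.1 ≤ q.2},
        if q.1.1 = q.1.2 then 0 else C q.1.1 q.1.2 * (F q.1.2 ⬝ᵥ H q.1.1)) +
      ∑ q : {q : Fin n × Fin n // q.1 ≤ q.2}, A q.1.1 q.1.2 * crossPairing F H q.1.1 q.1.2 := by
  rw [sum_sum_eq_sum_upper, ← Finset.sum_neg_distrib, ← Finset.sum_add_distrib]
  refine Finset.sum_congr rfl fun q _ => ?_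
  have hC : C q.1.1 q.1.2 = A q.1.1 q.1.2 - A q.1.2 q.1.1 := by
    rw [← (show A - Aᵀ = C from hA)]; rfl
  rw [crossPairing]
  split_ifs with h
  · rw [← h]; ring
  · rw [hC]; ring

theorem sum_mul_dotProduct_smul_rot {m n : ℕ} {C : Matrix (Fin n) (Fin n) (ZMod m)}
    (hC : IsAlternatingMatrix C) (F : Fin n → Fin 2 → ZMod m) (c : ZMod m) :
    (∑ q : {q : Fin n × Fin n // q.1 ≤ q.2},
      if q.1.1 = q.1.2 then 0 else C q.1.1 q.1.2 * (F q.1.2 ⬝ᵥ (c • rot (F q.1.1)))) =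
      c * ∑ i, ∑ j, C i j * (F i 0 * F j 1) := by
  rw [sum_sum_eq_sum_upper, Finset.mul_sum]
  refine Finset.sum_congr rfl fun q _ => ?_
  have h1 : C q.1.2 q.1.1 = -C q.1.1 q.1.2 := congrFun (congrFun hC.1 q.1.1) q.1.2
  split_ifs with h
  · rw [hC.2]; ring
  · rw [h1]
    simp only [rot, dotProduct, Fin.sum_univ_two, Pi.smul_apply, smul_eq_mul,
      Matrix.cons_val_zero, Matrix.cons_val_one]
    ring

theorem stdAddChar_sum {m : ℕ} [NeZero m] {ι : Type*} (s : Finset ι) (f : ι → ZMod m) :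
    (ZMod.stdAddChar (∑ i ∈ s, f i) : ℂ) = ∏ i ∈ s, ZMod.stdAddChar (f i) := by
  classical
  induction s using Finset.induction_on with
  | empty => simp
  | insert i s hi ih => rw [Finset.sum_insert hi, Finset.prod_insert hi, AddChar.map_add_eq_mul, ih]

theorem sum_stdAddChar_dotProduct {m n : ℕ} [NeZero m] (w : Fin n → Fin 2 → ZMod m) :
    ∑ H : Fin n → Fin 2 → ZMod m, (ZMod.stdAddChar (∑ j, w j ⬝ᵥ H j) : ℂ) =
      if ∀ j, w j = 0 then (Fintype.card (Fin n → Fin 2 → ZMod m) : ℂ) else 0 := by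
  split_ifs with hw
  · simp [hw]
  · push Not at hw
    obtain ⟨j, hj⟩ := hw
    obtain ⟨k, hk⟩ := Function.ne_iff.1 hj
    let f : (Fin n → Fin 2 → ZMod m) →+ ZMod m :=
      { toFun := fun H => ∑ j, w j ⬝ᵥ H j
        map_zero' := by simp
        map_add' := fun H H' => by simp [dotProduct_add, Finset.sum_add_distrib] }
    have hne : (ZMod.stdAddChar.compAddMonoidHom f :
        AddChar (Fin n → Fin 2 → ZMod m) ℂ) ≠ 0 := by
      intro h0
      -- Evaluating on a coordinate vector reads off a nonzero entry of w, so the character is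
      -- nontrivial and sums to 0.
      have h1 := DFunLike.congr_fun h0 (Pi.single j (Pi.single k 1))
      have hf : f (Pi.single j (Pi.single k 1)) = w j k := by
        change ∑ j', w j' ⬝ᵥ (Pi.single j (Pi.single k 1) : Fin n → Fin 2 → ZMod m) j' = _
        rw [Finset.sum_eq_single j]
        · simp
        · intro b _ hb
          simp [Pi.single_eq_of_ne hb]
        · simp
      rw [AddChar.compAddMonoidHom_apply, hf, AddChar.zero_apply,
        ← AddChar.map_zero_eq_one (ZMod.stdAddChar (N := m))] at h1
      exact hk (ZMod.injective_stdAddChar h1)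
    exact AddChar.sum_eq_zero_iff_ne_zero.2 hne

/-! ### The probability that X annihilates a fixed F -/

namespace IsBalancedCSymmetric

variable {a m n : ℕ} {Ω : Type*} [MeasurableSpace Ω] {μ : Measure Ω} {ε : ℝ}
  {C : Matrix (Fin n) (Fin n) (ZMod a)} {X : Ω → Matrix (Fin n) (Fin n) (ZMod a)}

theorem measurable_comp [NeZero a] (hX : IsBalancedCSymmetric μ ε C X)
    {β : Type*} [MeasurableSpace β] (f : Matrix (Fin n) (Fin n) (ZMod a) → β) :
    Measurable fun ω => f (X ω) :=
  (Measurable.of_discrete (f := fun Y : Fin n → Fin n → ZMod a => f Y)).comp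
    (measurable_pi_lambda _ fun i => measurable_pi_lambda _ fun j => hX.measurable i j)

theorem measurableSet_forall_sum_smul_eq_zero [NeZero a] (hX : IsBalancedCSymmetric μ ε C X)
    (hma : m ∣ a) (F : Fin n → Fin 2 → ZMod m) :
    MeasurableSet {ω | ∀ j, ∑ i, ZMod.castHom hma (ZMod m) (X ω i j) • F i = 0} :=
  measurableSet_setOfPred.2 (hX.measurable_comp fun Y =>
    ∀ j, ∑ i, ZMod.castHom hma (ZMod m) (Y i j) • F i = 0)

theorem integral_stdAddChar_eq [NeZero m] (hX : IsBalancedCSymmetric μ ε C X)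
    (hma : m ∣ a) (F H : Fin n → Fin 2 → ZMod m) :
    ∫ ω, (ZMod.stdAddChar
      (∑ i, ∑ j, ZMod.castHom hma (ZMod m) (X ω i j) * (F i ⬝ᵥ H j)) : ℂ) ∂μ =
    ZMod.stdAddChar (-∑ q : {q : Fin n × Fin n // q.1 ≤ q.2}, if q.1.1 = q.1.2 then 0 else
        C.map (ZMod.castHom hma (ZMod m)) q.1.1 q.1.2 * (F q.1.2 ⬝ᵥ H q.1.1)) *
      ∏ q : {q : Fin n × Fin n // q.1 ≤ q.2}, ∫ ω, (ZMod.stdAddChar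
        (ZMod.castHom hma (ZMod m) (X ω q.1.1 q.1.2) * crossPairing F H q.1.1 q.1.2) : ℂ) ∂μ := by
  rw [← hX.indep.integral_fun_prod_comp (f := fun q x => (ZMod.stdAddChar
        (ZMod.castHom hma (ZMod m) x * crossPairing F H q.1.1 q.1.2) : ℂ))
      (fun q => (hX.measurable _ _).aemeasurable)
      (fun q => measurable_from_top.aestronglyMeasurable), ← integral_const_mul]
  refine integral_congr_ae ?_
  filter_upwards [hX.symmetric] with ω hω
  have hA : IsCSymmetric (C.map (ZMod.castHom hma (ZMod m)))
      ((X ω).map (ZMod.castHom hma (ZMod m))) := by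
    rw [← (show X ω - (X ω)ᵀ = C from hω)]
    ext i j
    simp only [Matrix.sub_apply, Matrix.transpose_apply, Matrix.map_apply, map_sub]
  have := sum_mul_dotProduct_of_isCSymmetric hA F H
  simp only [Matrix.map_apply] at this ⊢
  rw [this, AddChar.map_add_eq_mul, stdAddChar_sum]

theorem norm_integral_stdAddChar_le [NeZero m] (hX : IsBalancedCSymmetric μ ε C X)
    [IsProbabilityMeasure μ] (hma : m ∣ a) {ρ : ℝ}
    (hρ : ∀ (N : Ω → ZMod a), Measurable N → IsBalanced μ ε N → ∀ t : ZMod m, t ≠ 0 →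
      ‖∫ ω, (ZMod.stdAddChar (ZMod.castHom hma (ZMod m) (N ω) * t) : ℂ) ∂μ‖ ≤ ρ)
    (F H : Fin n → Fin 2 → ZMod m) :
    ‖∫ ω, (ZMod.stdAddChar
      (∑ i, ∑ j, ZMod.castHom hma (ZMod m) (X ω i j) * (F i ⬝ᵥ H j)) : ℂ) ∂μ‖ ≤
      ρ ^ crossSupport F H := by
  rw [hX.integral_stdAddChar_eq hma, norm_mul, AddChar.norm_apply, one_mul, norm_prod, crossSupport,
    ← Finset.prod_const, Finset.prod_filter]
  refine Finset.prod_le_prod (fun _ _ => norm_nonneg _) fun q _ => ?_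
  split_ifs with hq
  · exact hρ _ (hX.measurable _ _) (hX.balanced _ _ q.2) _ hq
  · rw [not_not] at hq
    simp [hq]

theorem integral_stdAddChar_smul_rot [NeZero m] (hX : IsBalancedCSymmetric μ ε C X)
    [IsProbabilityMeasure μ] (hC : IsAlternatingMatrix C) (hma : m ∣ a)
    (F : Fin n → Fin 2 → ZMod m)
    (hF : ∑ i, ∑ j, C.map (ZMod.castHom hma (ZMod m)) i j * (F i 0 * F j 1) = 0) (c : ZMod m) :
    ∫ ω, (ZMod.stdAddChar
      (∑ i, ∑ j, ZMod.castHom hma (ZMod m) (X ω i j) * (F i ⬝ᵥ (c • rot (F j)))) : ℂ) ∂μ = 1 := by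
  have hC' : IsAlternatingMatrix (C.map (ZMod.castHom hma (ZMod m))) := by
    refine ⟨?_, fun i => by rw [Matrix.map_apply, hC.2, map_zero]⟩
    rw [← Matrix.transpose_map, hC.1]
    ext i j
    simp only [Matrix.map_apply, Matrix.neg_apply, map_neg]
  rw [hX.integral_stdAddChar_eq hma F fun j => c • rot (F j), sum_mul_dotProduct_smul_rot hC', hF]
  simp [crossPairing_smul_rot]

/-- Lower bound for the probability that `F` induces a homomorphism from the cokernel. -/
theorem le_card_mul_measureReal [NeZero a] [NeZero m] (hX : IsBalancedCSymmetric μ ε C X)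
    [IsProbabilityMeasure μ] (hC : IsAlternatingMatrix C) (hma : m ∣ a) {ρ : ℝ}
    (hρ : ∀ (N : Ω → ZMod a), Measurable N → IsBalanced μ ε N → ∀ t : ZMod m, t ≠ 0 →
      ‖∫ ω, (ZMod.stdAddChar (ZMod.castHom hma (ZMod m) (N ω) * t) : ℂ) ∂μ‖ ≤ ρ)
    {F : Fin n → Fin 2 → ZMod m} (hFs : Function.Surjective F)
    (hF : ∑ i, ∑ j, C.map (ZMod.castHom hma (ZMod m)) i j * (F i 0 * F j 1) = 0) :
    (m : ℝ) - ∑ H ∈ (rotMultiples F)ᶜ, ρ ^ crossSupport F H ≤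
      Fintype.card (Fin n → Fin 2 → ZMod m) *
        μ.real {ω | ∀ j, ∑ i, ZMod.castHom hma (ZMod m) (X ω i j) • F i = 0} := by
  classical
  set A : Set Ω := {ω | ∀ j, ∑ i, ZMod.castHom hma (ZMod m) (X ω i j) • F i = 0} with hAdef
  have hA : MeasurableSet A := hX.measurableSet_forall_sum_smul_eq_zero hma F
  set E : (Fin n → Fin 2 → ZMod m) → ℂ := fun H => ∫ ω, (ZMod.stdAddChar
      (∑ i, ∑ j, ZMod.castHom hma (ZMod m) (X ω i j) * (F i ⬝ᵥ H j)) : ℂ) ∂μ with hE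
  have hint : ∀ H : Fin n → Fin 2 → ZMod m, Integrable (fun ω => (ZMod.stdAddChar
      (∑ i, ∑ j, ZMod.castHom hma (ZMod m) (X ω i j) * (F i ⬝ᵥ H j)) : ℂ)) μ := by
    intro H
    refine Integrable.of_bound (C := 1) ?_ (ae_of_all _ fun ω => (AddChar.norm_apply _ _).le)
    exact (hX.measurable_comp fun Y => (ZMod.stdAddChar
      (∑ i, ∑ j, ZMod.castHom hma (ZMod m) (Y i j) * (F i ⬝ᵥ H j)) : ℂ)).aestronglyMeasurable
  -- Fourier inversion: the characters sum to the indicator of annihilation times the number of H.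
  have hsum : ((Fintype.card (Fin n → Fin 2 → ZMod m) * μ.real A : ℝ) : ℂ) = ∑ H, E H := by
    rw [hE, ← integral_finsetSum _ fun H _ => hint H]
    have : ∀ ω, ∑ H : Fin n → Fin 2 → ZMod m, (ZMod.stdAddChar
        (∑ i, ∑ j, ZMod.castHom hma (ZMod m) (X ω i j) * (F i ⬝ᵥ H j)) : ℂ) =
        A.indicator (fun _ => (Fintype.card (Fin n → Fin 2 → ZMod m) : ℂ)) ω := by
      intro ω
      have h2 : ∀ H : Fin n → Fin 2 → ZMod m,
          ∑ i, ∑ j, ZMod.castHom hma (ZMod m) (X ω i j) * (F i ⬝ᵥ H j) =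
          ∑ j, (∑ i, ZMod.castHom hma (ZMod m) (X ω i j) • F i) ⬝ᵥ H j := by
        intro H
        rw [Finset.sum_comm]
        refine Finset.sum_congr rfl fun j _ => ?_
        rw [sum_dotProduct]
        exact Finset.sum_congr rfl fun i _ => by rw [smul_dotProduct, smul_eq_mul]
      simp only [h2, sum_stdAddChar_dotProduct, Set.indicator_apply, hAdef, Set.mem_ofPred_eq]
    simp only [this]
    rw [integral_indicator_const _ hA, Complex.real_smul]
    push_cast
    ring
  have hspec : ∑ H ∈ rotMultiples F, E H = m := by
    have h1 : ∀ H ∈ rotMultiples F, E H = 1 := fun H hH => by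
      obtain ⟨c, -, rfl⟩ := Finset.mem_image.1 hH
      exact hX.integral_stdAddChar_smul_rot hC hma F hF c
    rw [Finset.sum_congr rfl h1, Finset.sum_const, card_rotMultiples hFs, nsmul_one]
  have hre : (Fintype.card (Fin n → Fin 2 → ZMod m) * μ.real A : ℝ) =
      m + (∑ H ∈ (rotMultiples F)ᶜ, E H).re := by
    rw [← Complex.ofReal_re (Fintype.card (Fin n → Fin 2 → ZMod m) * μ.real A), hsum,
      ← Finset.sum_add_sum_compl (rotMultiples F), hspec, Complex.add_re, Complex.natCast_re]
  have hbound : ‖∑ H ∈ (rotMultiples F)ᶜ, E H‖ ≤ ∑ H ∈ (rotMultiples F)ᶜ, ρ ^ crossSupport F H :=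
    norm_sum_le_of_le _ fun H _ => hX.norm_integral_stdAddChar_le hma hρ F H
  have := (abs_le.1 (Complex.abs_re_le_norm (∑ H ∈ (rotMultiples F)ᶜ, E H))).1
  linarith

end IsBalancedCSymmetric

/-! ### Nonspecial characters meet many entries -/

theorem crossPairing_comm {m n : ℕ} (F H : Fin n → Fin 2 → ZMod m) (i j : Fin n) :
    crossPairing F H i j = crossPairing F H j i := by
  rcases eq_or_ne i j with rfl | h
  · rfl
  · rw [crossPairing, crossPairing, if_neg h, if_neg h.symm, add_comm]

theorem card_crossPairing_ne_zero_le {m n : ℕ} (F H : Fin n → Fin 2 → ZMod m) :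
    (Finset.univ.filter fun q : Fin n × Fin n => crossPairing F H q.1 q.2 ≠ 0).card ≤
      2 * crossSupport F H := by
  classical
  set U := Finset.univ.filter fun q : {q : Fin n × Fin n // q.1 ≤ q.2} =>
    crossPairing F H q.1.1 q.1.2 ≠ 0 with hU
  have hsub : (Finset.univ.filter fun q : Fin n × Fin n => crossPairing F H q.1 q.2 ≠ 0) ⊆
      U.image (fun q => q.1) ∪ U.image (fun q => q.1.swap) := by
    intro q hq
    rw [Finset.mem_filter] at hq
    rw [Finset.mem_union, Finset.mem_image, Finset.mem_image]
    rcases le_total q.1 q.2 with h | h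
    · exact Or.inl ⟨⟨q, h⟩, by simpa [hU] using hq.2, rfl⟩
    · refine Or.inr ⟨⟨q.swap, h⟩, ?_, Prod.swap_swap q⟩
      rw [hU, Finset.mem_filter]
      exact ⟨Finset.mem_univ _, by rw [crossPairing_comm]; exact hq.2⟩
  refine (Finset.card_le_card hsub).trans ((Finset.card_union_le _ _).trans ?_)
  have h1 := Finset.card_image_le (s := U) (f := fun q => q.1)
  have h2 := Finset.card_image_le (s := U) (f := fun q => q.1.swap)
  have h3 : U.card = crossSupport F H := rfl
  lia

theorem exists_popular_value {ι β γ : Type*} [Fintype ι] [Fintype γ] [Nonempty γ] [DecidableEq β]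
    [DecidableEq γ] (F : ι → β) (H : ι → γ) (g : β) :
    ∃ φ, (Finset.univ.filter fun i => F i = g).card ≤
      Fintype.card γ * (Finset.univ.filter fun i => F i = g ∧ H i = φ).card := by
  by_contra! hcon
  have h1 := Finset.card_eq_sum_card_fiberwise (f := H)
    (s := Finset.univ.filter fun i => F i = g) (t := Finset.univ) (fun _ _ => Finset.mem_univ _)
  simp only [Finset.filter_filter] at h1
  have h2 : ∑ φ, Fintype.card γ * (Finset.univ.filter fun i => F i = g ∧ H i = φ).card <
      ∑ _φ : γ, (Finset.univ.filter fun i => F i = g).card :=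
    Finset.sum_lt_sum_of_nonempty Finset.univ_nonempty fun φ _ => hcon φ
  rw [← Finset.mul_sum, ← h1, Finset.sum_const, Finset.card_univ, smul_eq_mul] at h2
  exact lt_irrefl _ h2

/-- Skewness against the basis vectors makes α linear, and an alternating 2 × 2 matrix is a multiple
of the rotation. The diagonal condition is separate because m may be even. -/
theorem eq_smul_rot_of_alternating {m : ℕ} {α : (Fin 2 → ZMod m) → Fin 2 → ZMod m}
    (hskew : ∀ g g', α g ⬝ᵥ g' + α g' ⬝ᵥ g = 0) (halt : ∀ g, α g ⬝ᵥ g = 0)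
    (g : Fin 2 → ZMod m) : α g = α ![1, 0] 1 • rot g := by
  have h1 := hskew g ![1, 0]
  have h2 := hskew g ![0, 1]
  have h3 := hskew ![1, 0] ![0, 1]
  have h4 := halt ![1, 0]
  have h5 := halt ![0, 1]
  simp only [dotProduct, Fin.sum_univ_two, Matrix.cons_val_zero, Matrix.cons_val_one, mul_one,
    mul_zero, add_zero, zero_add] at h1 h2 h3 h4 h5
  ext k
  fin_cases k
  · change α g 0 = α ![1, 0] 1 * -g 1
    linear_combination h1 - g 0 * h4
  · change α g 1 = α ![1, 0] 1 * g 0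
    linear_combination h2 - g 0 * h3 - g 1 * h5

/-- If every value of `F` is frequent, then for every `H` which is not a multiple of `rot ∘ F`,
either `crossSupport F H` is of quadratic size, or `H` is close to a function of `F`. -/
theorem crossSupport_dichotomy {m n K : ℕ} [NeZero m] {F H : Fin n → Fin 2 → ZMod m}
    (hF : ∀ g, n ≤ K * (Finset.univ.filter fun i => F i = g).card) (hH : H ∉ rotMultiples F) :
    n ^ 2 ≤ 4 * (K * Fintype.card (Fin 2 → ZMod m)) ^ 2 * crossSupport F H ∨
    ∃ α : (Fin 2 → ZMod m) → Fin 2 → ZMod m,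
      n * (1 + (Finset.univ.filter fun j => H j ≠ α (F j)).card) ≤
        4 * (K * Fintype.card (Fin 2 → ZMod m)) ^ 2 * crossSupport F H := by
  classical
  set L := K * Fintype.card (Fin 2 → ZMod m) with hL
  have hLL : L ≤ L ^ 2 := Nat.le_self_pow two_ne_zero L
  have hN := card_crossPairing_ne_zero_le F H
  set N := crossSupport F H with hNdef
  have hpop : ∀ g, ∃ φ, n ≤ L * (Finset.univ.filter fun i => F i = g ∧ H i = φ).card := by
    intro g
    obtain ⟨φ, hφ⟩ := exists_popular_value F H g
    exact ⟨φ, (hF g).trans (by rw [hL, mul_assoc]; exact Nat.mul_le_mul_left K hφ)⟩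
  -- α g is a most frequent value of H where F = g; each such pair occurs at least n / L times.
  choose α hα using hpop
  by_cases hskew : ∀ g g', α g ⬝ᵥ g' + α g' ⬝ᵥ g = 0
  · refine Or.inr ⟨α, ?_⟩
    set bad := Finset.univ.filter fun j => H j ≠ α (F j) with hbad
    -- If H j differs from α (F j) in coordinate k, every i with F i the k-th basis vector and H i
    -- its α-value has nonzero pairing with j: by skewness the pairing is that coordinate of the
    -- difference.
    have hrow : ∀ j ∈ bad, n ≤ L * (Finset.univ.filter fun i => crossPairing F H i j ≠ 0).card := by
      intro j hj
      have hj' : H j - α (F j) ≠ 0 := sub_ne_zero.2 (Finset.mem_filter.1 hj).2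
      obtain ⟨k, hk⟩ := Function.ne_iff.1 hj'
      refine (hα (Pi.single k 1)).trans (Nat.mul_le_mul_left L (Finset.card_le_card ?_))
      intro i hi
      simp only [Finset.mem_filter, Finset.mem_univ, true_and] at hi ⊢
      have hij : i ≠ j := by
        rintro rfl
        exact (Finset.mem_filter.1 hj).2 (by rw [hi.2, hi.1])
      rw [crossPairing, if_neg hij, hi.1, hi.2]
      have h1 := hskew (F j) (Pi.single k 1)
      rw [dotProduct_comm (α (Pi.single k 1))] at h1
      rw [eq_neg_of_add_eq_zero_right h1, dotProduct_comm, ← sub_eq_add_neg, ← sub_dotProduct,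
        dotProduct_single, mul_one]
      exact hk
    rcases Nat.eq_zero_or_pos bad.card with h0 | hpos
    · rw [h0, add_zero, mul_one]
      have hHα : ∀ j, H j = α (F j) := by
        intro j
        by_contra hj
        exact (Finset.card_pos.2 ⟨j, by simpa [hbad] using hj⟩).ne' h0
      -- Now H = α ∘ F with α skew. As H is not special, α is not alternating, and the diagonal
      -- positions supply the n / L nonzero pairings.
      have halt : ¬ ∀ g, α g ⬝ᵥ g = 0 := by
        intro halt
        refine hH (Finset.mem_image.2 ⟨α ![1, 0] 1, Finset.mem_univ _, ?_⟩)
        funext i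
        rw [hHα i, ← eq_smul_rot_of_alternating hskew halt]
      push Not at halt
      obtain ⟨g, hg⟩ := halt
      have hle : (Finset.univ.filter fun i => F i = g ∧ H i = α g).card ≤ N := by
        refine Finset.card_le_card_of_injOn (fun i => ⟨(i, i), le_rfl⟩) ?_ ?_
        · intro i hi
          simp only [Finset.coe_filter, Finset.mem_univ, true_and, Set.mem_ofPred_eq] at hi ⊢
          rw [crossPairing, if_pos rfl, hi.1, hi.2, dotProduct_comm]
          exact hg
        · intro i _ j _ hij
          simpa using hij
      calc n ≤ L * (Finset.univ.filter fun i => F i = g ∧ H i = α g).card := hα g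
        _ ≤ L * N := Nat.mul_le_mul_left _ hle
        _ ≤ L ^ 2 * N := Nat.mul_le_mul_right _ hLL
        _ ≤ 4 * L ^ 2 * N := Nat.mul_le_mul_right _ (by lia)
    · have hsum : n * bad.card ≤ L * (2 * N) := by
        calc n * bad.card = ∑ _j ∈ bad, n := by rw [Finset.sum_const, smul_eq_mul, mul_comm]
          _ ≤ ∑ j ∈ bad, L * (Finset.univ.filter fun i => crossPairing F H i j ≠ 0).card :=
            Finset.sum_le_sum hrow
          _ ≤ ∑ j, L * (Finset.univ.filter fun i => crossPairing F H i j ≠ 0).card :=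
            Finset.sum_le_sum_of_subset (Finset.subset_univ _)
          _ = L * (Finset.univ.filter
                fun q : Fin n × Fin n => crossPairing F H q.1 q.2 ≠ 0).card := by
            rw [← Finset.mul_sum]
            congr 1
            simp only [Finset.card_filter, ← Finset.univ_product_univ, Finset.sum_product_right]
          _ ≤ L * (2 * N) := Nat.mul_le_mul_left _ hN
      -- One factor 2 comes from absorbing the 1, the other from counting ordered pairs; hence the
      -- constant 4.
      have h1 : n * (1 + bad.card) ≤ 2 * (n * bad.card) := by nlinarith
      have h2 : L * N ≤ L ^ 2 * N := Nat.mul_le_mul_right _ hLL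
      nlinarith
  · push Not at hskew
    obtain ⟨g, g', hg⟩ := hskew
    refine Or.inl ?_
    have hsub : (Finset.univ.filter fun i => F i = g ∧ H i = α g) ×ˢ
        (Finset.univ.filter fun i => F i = g' ∧ H i = α g') ⊆
        Finset.univ.filter fun q : Fin n × Fin n => crossPairing F H q.1 q.2 ≠ 0 := by
      rintro ⟨i, j⟩ hq
      simp only [Finset.mem_product, Finset.mem_filter, Finset.mem_univ, true_and] at hq ⊢
      obtain ⟨⟨h1, h2⟩, h3, h4⟩ := hq
      rw [crossPairing]
      split_ifs with hij
      · subst hij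
        intro h0
        rw [dotProduct_comm] at h0
        refine hg ?_
        rw [← h2, ← h4, ← h1, ← h3, h0, add_zero]
      · rw [h1, h2, h3, h4, dotProduct_comm, dotProduct_comm g', add_comm]
        exact hg
    have hcard := (Finset.card_le_card hsub).trans hN
    rw [Finset.card_product] at hcard
    calc n ^ 2 = n * n := sq n
      _ ≤ _ := Nat.mul_le_mul (hα g) (hα g')
      _ = L ^ 2 * _ := by rw [mul_mul_mul_comm, ← sq]
      _ ≤ L ^ 2 * (2 * N) := Nat.mul_le_mul_left _ hcard
      _ ≤ 4 * L ^ 2 * N := by nlinarith [Nat.zero_le (L ^ 2 * N)]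

/-! ### Summing the error terms -/

theorem sum_prod_apply {ι γ : Type*} [Fintype ι] [DecidableEq ι] [Fintype γ] (w : ι → γ → ℝ) :
    ∑ H : ι → γ, ∏ i, w i (H i) = ∏ i, ∑ φ, w i φ := by
  rw [Finset.prod_univ_sum, Fintype.piFinset_univ]

theorem sum_pow_card_ne_le {γ : Type*} [Fintype γ] [DecidableEq γ] {n : ℕ} (f : Fin n → γ)
    {τ : ℝ} (hτ : 0 ≤ τ) :
    ∑ H : Fin n → γ, τ ^ (Finset.univ.filter fun j => H j ≠ f j).card ≤
      (1 + Fintype.card γ * τ) ^ n := by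
  have h1 : ∀ H : Fin n → γ, τ ^ (Finset.univ.filter fun j => H j ≠ f j).card =
      ∏ j, if H j ≠ f j then τ else 1 := fun H => by
    rw [← Finset.prod_const, Finset.prod_filter]
  simp only [h1]
  rw [sum_prod_apply fun j φ => if φ ≠ f j then τ else 1]
  calc ∏ j, ∑ φ, (if φ ≠ f j then τ else 1) ≤ ∏ _j : Fin n, (1 + Fintype.card γ * τ) := by
        refine Finset.prod_le_prod
          (fun j _ => Finset.sum_nonneg fun φ _ => by split_ifs <;> positivity) fun j _ => ?_
        calc ∑ φ, (if φ ≠ f j then τ else 1) ≤ ∑ φ, ((if φ = f j then 1 else 0) + τ) :=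
              Finset.sum_le_sum fun φ _ => by
                by_cases h : φ = f j <;> simp [h, hτ]
          _ = 1 + Fintype.card γ * τ := by
            simp [Finset.sum_add_distrib]
    _ = _ := by simp

/-- The contribution of the characters that are not multiples of `rot ∘ F`. -/
theorem sum_pow_crossSupport_le {m n K : ℕ} [NeZero m] {F : Fin n → Fin 2 → ZMod m}
    (hF : ∀ g, n ≤ K * (Finset.univ.filter fun i => F i = g).card) {ρ σ : ℝ} (hσ0 : 0 ≤ σ)
    (hσ1 : σ ≤ 1) (hρ : ρ = σ ^ (4 * (K * Fintype.card (Fin 2 → ZMod m)) ^ 2)) :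
    ∑ H ∈ (rotMultiples F)ᶜ, ρ ^ crossSupport F H ≤
      (Fintype.card (Fin 2 → ZMod m) * σ ^ n) ^ n +
      Fintype.card ((Fin 2 → ZMod m) → Fin 2 → ZMod m) *
        (σ ^ n * (1 + Fintype.card (Fin 2 → ZMod m) * σ ^ n) ^ n) := by
  classical
  -- The two alternatives of the dichotomy, with all α summed over. The exponent relating ρ to σ is
  -- exactly its constant.
  have hterm : ∀ H ∈ (rotMultiples F)ᶜ, ρ ^ crossSupport F H ≤ (σ ^ n) ^ n +
      ∑ α : (Fin 2 → ZMod m) → Fin 2 → ZMod m,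
        σ ^ n * (σ ^ n) ^ (Finset.univ.filter fun j => H j ≠ α (F j)).card := by
    intro H hH
    have hnn : ∀ α : (Fin 2 → ZMod m) → Fin 2 → ZMod m,
        0 ≤ σ ^ n * (σ ^ n) ^ (Finset.univ.filter fun j => H j ≠ α (F j)).card :=
      fun α => by positivity
    rw [hρ, ← pow_mul]
    rcases crossSupport_dichotomy hF (Finset.mem_compl.1 hH) with h | ⟨α, h⟩
    · refine le_add_of_le_of_nonneg ?_ (Finset.sum_nonneg fun α _ => hnn α)
      rw [← pow_mul, ← sq]
      exact pow_le_pow_of_le_one hσ0 hσ1 h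
    · refine le_add_of_nonneg_of_le (by positivity) (le_trans ?_
        (Finset.single_le_sum (fun α _ => hnn α) (Finset.mem_univ α)))
      rw [← pow_succ', ← pow_mul, add_comm _ 1]
      exact pow_le_pow_of_le_one hσ0 hσ1 h
  refine (Finset.sum_le_sum hterm).trans ((Finset.sum_le_sum_of_subset_of_nonneg
    (Finset.subset_univ _) fun _ _ _ => by positivity).trans ?_)
  rw [Finset.sum_add_distrib, Finset.sum_comm]
  refine add_le_add (le_of_eq ?_) ?_
  · simp [mul_pow]
  · rw [← nsmul_eq_mul, ← Finset.card_univ]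
    refine Finset.sum_le_card_nsmul _ _ _ fun α _ => ?_
    rw [← Finset.mul_sum]
    exact mul_le_mul_of_nonneg_left (sum_pow_card_ne_le _ (by positivity)) (by positivity)

theorem tendsto_error_bound {σ : ℝ} (hσ0 : 0 ≤ σ) (hσ1 : σ < 1) (M T : ℕ) :
    Tendsto (fun n : ℕ => (M * σ ^ n) ^ n + T * (σ ^ n * (1 + M * σ ^ n) ^ n)) atTop (𝓝 0) := by
  have hpow : Tendsto (fun n : ℕ => σ ^ n) atTop (𝓝 0) := tendsto_pow_atTop_nhds_zero_of_lt_one hσ0 hσ1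
  have h1 : Tendsto (fun n : ℕ => (M * σ ^ n) ^ n) atTop (𝓝 0) := by
    have h2 : ∀ᶠ n : ℕ in atTop, M * σ ^ n < 1 / 2 := by
      have : Tendsto (fun n : ℕ => M * σ ^ n) atTop (𝓝 (M * 0)) := hpow.const_mul _
      rw [mul_zero] at this
      exact this.eventually_lt_const (by norm_num)
    refine squeeze_zero' (Eventually.of_forall fun n => by positivity) ?_
      (tendsto_pow_atTop_nhds_zero_of_lt_one (by norm_num : (0 : ℝ) ≤ 1 / 2) (by norm_num))
    filter_upwards [h2] with n hn
    exact pow_le_pow_left₀ (by positivity) hn.le n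
  -- Since n σ^n → 0, the exponential dominating (1 + M σ^n)^n stays bounded.
  have h3 : Tendsto (fun n : ℕ => σ ^ n * Real.exp (M * (n * σ ^ n))) atTop (𝓝 0) := by
    have h4 : Tendsto (fun n : ℕ => (n : ℝ) * σ ^ n) atTop (𝓝 0) :=
      tendsto_self_mul_const_pow_of_lt_one hσ0 hσ1
    have h5 := hpow.mul ((Real.continuous_exp.tendsto _).comp (h4.const_mul (M : ℝ)))
    rw [zero_mul] at h5
    exact h5
  have h6 : Tendsto (fun n : ℕ => σ ^ n * (1 + M * σ ^ n) ^ n) atTop (𝓝 0) := by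
    refine squeeze_zero (fun n => by positivity) (fun n => ?_) h3
    refine mul_le_mul_of_nonneg_left ?_ (by positivity)
    calc (1 + M * σ ^ n) ^ n ≤ Real.exp (M * σ ^ n) ^ n :=
          pow_le_pow_left₀ (by positivity) (by rw [add_comm]; exact Real.add_one_le_exp _) n
      _ = Real.exp (M * (n * σ ^ n)) := by rw [← Real.exp_nat_mul]; ring_nf
  simpa using h1.add (h6.const_mul (T : ℝ))

/-- Most functions `Fin n → γ` take every value with positive frequency. -/
theorem exists_tendsto_card_infrequent (γ : Type*) [Fintype γ] [DecidableEq γ] [Nonempty γ] :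
    ∃ K : ℕ, 0 < K ∧ Tendsto (fun n : ℕ => ((Finset.univ.filter fun F : Fin n → γ =>
      ¬ ∀ g, n ≤ K * (Finset.univ.filter fun i => F i = g).card).card : ℝ) /
        Fintype.card (Fin n → γ)) atTop (𝓝 0) := by
  set M : ℝ := (Fintype.card γ : ℝ) with hM
  have hM1 : 1 ≤ M := by rw [hM]; exact_mod_cast Fintype.card_pos (α := γ)
  -- Chernoff bound: weighting each occurrence of g by s^(-K) < 1/2 bounds the total weight by (M -
  -- 1/2)^n. Removing the weight costs at most s^n, and s is so close to 1 that s (M - 1/2) < M.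
  set s : ℝ := 1 + 1 / (2 * M) with hs
  have hs1 : 1 < s := by rw [hs]; have : 0 < 1 / (2 * M) := by positivity
                         linarith
  have hr : s * (M - 1 / 2) / M < 1 := by
    rw [div_lt_one (by positivity), hs]
    have : (1 + 1 / (2 * M)) * (M - 1 / 2) = M - 1 / (4 * M) := by field_simp; ring
    rw [this]
    have : 0 < 1 / (4 * M) := by positivity
    linarith
  obtain ⟨K, hK⟩ := pow_unbounded_of_one_lt 2 hs1
  have hK0 : 0 < K := by
    rcases Nat.eq_zero_or_pos K with rfl | h
    · norm_num at hK
    · exact h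
  refine ⟨K, hK0, ?_⟩
  have hone : ∀ (n : ℕ) (g : γ), ((Finset.univ.filter fun F : Fin n → γ =>
      K * (Finset.univ.filter fun i => F i = g).card < n).card : ℝ) ≤
        (s * (M - 1 / 2)) ^ n := by
    intro n g
    have hsum : ∑ F : Fin n → γ, ((s ^ K)⁻¹) ^ (Finset.univ.filter fun i => F i = g).card ≤
        (M - 1 / 2) ^ n := by
      have h1 : ∀ F : Fin n → γ, ((s ^ K)⁻¹) ^ (Finset.univ.filter fun i => F i = g).card =
          ∏ i, if F i = g then (s ^ K)⁻¹ else 1 := fun F => by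
        rw [← Finset.prod_const, Finset.prod_filter]
      simp only [h1]
      rw [sum_prod_apply fun _ φ => if φ = g then (s ^ K)⁻¹ else 1]
      rw [Finset.prod_const, Finset.card_univ, Fintype.card_fin]
      have h2 : ∑ φ, (if φ = g then (s ^ K)⁻¹ else 1) = M - 1 + (s ^ K)⁻¹ := by
        have : ∀ φ, (if φ = g then (s ^ K)⁻¹ else 1) =
            1 + if φ = g then (s ^ K)⁻¹ - 1 else 0 := fun φ => by split_ifs <;> ring
        simp only [this, Finset.sum_add_distrib, Finset.sum_ite_eq', Finset.mem_univ, if_true,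
          Finset.sum_const, Finset.card_univ, nsmul_eq_mul, mul_one]
        ring
      rw [h2]
      have h3 : (s ^ K)⁻¹ ≤ 1 / 2 := by
        rw [one_div]
        exact inv_anti₀ two_pos hK.le
      have h4 : 0 < (s ^ K)⁻¹ := by positivity
      exact pow_le_pow_left₀ (by linarith) (by linarith) n
    rw [Finset.card_filter, Nat.cast_sum, mul_pow]
    refine le_trans ?_ (mul_le_mul_of_nonneg_left hsum (by positivity))
    rw [Finset.mul_sum]
    refine Finset.sum_le_sum fun F _ => ?_
    split_ifs with h
    · rw [inv_pow, ← pow_mul, Nat.cast_one, ← div_eq_mul_inv, one_le_div (by positivity)]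
      exact pow_le_pow_right₀ hs1.le h.le
    · rw [Nat.cast_zero]
      positivity
  have hr0 : 0 ≤ s * (M - 1 / 2) / M := by
    have : 0 ≤ M - 1 / 2 := by linarith
    positivity
  have hlim := (tendsto_pow_atTop_nhds_zero_of_lt_one hr0 hr).const_mul M
  rw [mul_zero] at hlim
  refine squeeze_zero (fun n => by positivity) (fun n => ?_) hlim
  have hsub : (Finset.univ.filter fun F : Fin n → γ =>
      ¬ ∀ g, n ≤ K * (Finset.univ.filter fun i => F i = g).card) ⊆
      Finset.univ.biUnion fun g => Finset.univ.filter fun F : Fin n → γ =>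
        K * (Finset.univ.filter fun i => F i = g).card < n := by
    intro F hF
    simpa using hF
  have hcard := (Finset.card_le_card hsub).trans Finset.card_biUnion_le
  have hcard' : ((Finset.univ.filter fun F : Fin n → γ =>
      ¬ ∀ g, n ≤ K * (Finset.univ.filter fun i => F i = g).card).card : ℝ) ≤
      M * (s * (M - 1 / 2)) ^ n := by
    calc _ ≤ ((∑ g : γ, (Finset.univ.filter fun F : Fin n → γ =>
            K * (Finset.univ.filter fun i => F i = g).card < n).card : ℕ) : ℝ) := by
          exact_mod_cast hcard
      _ ≤ ∑ _g : γ, (s * (M - 1 / 2)) ^ n := by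
          rw [Nat.cast_sum]
          exact Finset.sum_le_sum fun g _ => hone n g
      _ = _ := by simp [hM]
  have hc : (Fintype.card (Fin n → γ) : ℝ) = M ^ n := by simp [hM]
  rw [hc, div_pow, ← mul_div_assoc]
  gcongr

/-! ### Zeros of a bilinear form of bounded rank -/

theorem card_le_card_fiber_zero_mul {A B : Type*} [AddCommGroup A] [AddCommGroup B] [Fintype A]
    [DecidableEq B] (f : A →+ B) {N : ℕ} (hN : Nat.card f.range ≤ N) :
    Fintype.card A ≤ (Finset.univ.filter fun x => f x = 0).card * N := by
  have h1 := f.ker.card_mul_index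
  rw [AddSubgroup.index_ker] at h1
  have h2 : Nat.card f.ker = (Finset.univ.filter fun x => f x = 0).card := by
    rw [← Fintype.card_subtype, ← Nat.card_eq_fintype_card]
    rfl
  rw [← Nat.card_eq_fintype_card, ← h1, h2]
  exact Nat.mul_le_mul_left _ hN

theorem card_range_mulVecLin {p n : ℕ} [Fact p.Prime] (D : Matrix (Fin n) (Fin n) (ZMod p)) :
    Nat.card (LinearMap.range D.mulVecLin) = p ^ D.rank := by
  rw [Module.natCard_eq_pow_finrank (K := ZMod p), Nat.card_zmod, Matrix.rank]

/-- The number of zeros of the reduction modulo `p` of a bilinear form of bounded rank. -/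
theorem card_bilinear_zero_ge {m n p B : ℕ} [NeZero m] (hp : p.Prime) (hpm : p ∣ m)
    (D : Matrix (Fin n) (Fin n) (ZMod p)) (hD : D.rank ≤ B) :
    (p ^ B + (p - 1)) * Fintype.card (Fin n → Fin 2 → ZMod m) ≤
      p * p ^ B * (Finset.univ.filter fun F : Fin n → Fin 2 → ZMod m =>
        ∑ i, ∑ j, D i j * (ZMod.castHom hpm (ZMod p) (F i 0) *
          ZMod.castHom hpm (ZMod p) (F j 1)) = 0).card := by
  classical
  have : Fact p.Prime := ⟨hp⟩
  set c := ZMod.castHom hpm (ZMod p) with hc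
  set Q := Fintype.card (Fin n → ZMod m) with hQ
  let e : (Fin n → Fin 2 → ZMod m) ≃ (Fin n → ZMod m) × (Fin n → ZMod m) :=
    (Equiv.piComm _).trans (finTwoArrowEquiv _)
  let f (y : Fin n → ZMod m) : (Fin n → ZMod m) →+ ZMod p :=
    { toFun := fun x => ∑ i, ∑ j, D i j * (c (x i) * c (y j))
      map_zero' := by simp
      map_add' := fun x x' => by simp [add_mul, mul_add, Finset.sum_add_distrib] }
  let k : (Fin n → ZMod m) →+ (Fin n → ZMod p) :=
    { toFun := fun y => D.mulVecLin fun j => c (y j)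
      map_zero' := by
        simp only [Pi.zero_apply, map_zero]
        exact map_zero D.mulVecLin
      map_add' := fun y y' => by
        rw [← map_add]
        congr 1
        funext j
        simp }
  have hcardF : Fintype.card (Fin n → Fin 2 → ZMod m) = Q * Q := by
    rw [Fintype.card_congr e, Fintype.card_prod]
  have hker : Q ≤ (Finset.univ.filter fun y => k y = 0).card * p ^ B := by
    refine card_le_card_fiber_zero_mul k ?_
    calc Nat.card k.range ≤ Nat.card (LinearMap.range D.mulVecLin) :=
          Nat.card_mono (Set.toFinite _) (by rintro _ ⟨y, rfl⟩; exact ⟨_, rfl⟩)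
      _ = p ^ D.rank := card_range_mulVecLin D
      _ ≤ p ^ B := Nat.pow_le_pow_right hp.pos hD
  have hcount : (Finset.univ.filter fun F : Fin n → Fin 2 → ZMod m =>
        ∑ i, ∑ j, D i j * (c (F i 0) * c (F j 1)) = 0).card =
      ∑ y, (Finset.univ.filter fun x => f y x = 0).card := by
    simp only [Finset.card_filter]
    rw [← Finset.sum_product_right', Finset.univ_product_univ]
    exact Fintype.sum_equiv e _ _ fun F => rfl
  -- Every y has at least the proportion 1/p of zeros x, being those of a homomorphism to ℤ/p; for y
  -- in the kernel of D, of density at least p^(-B), all x are zeros.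
  have hy : ∀ y, (Q + if k y = 0 then (p - 1) * Q else 0) ≤
      p * (Finset.univ.filter fun x => f y x = 0).card := by
    intro y
    split_ifs with hky
    · have hall : ∀ x, f y x = 0 := by
        intro x
        change ∑ i, ∑ j, D i j * (c (x i) * c (y j)) = 0
        refine Finset.sum_eq_zero fun i _ => ?_
        have h1 : ∑ j, D i j * c (y j) = 0 := congrFun hky i
        calc ∑ j, D i j * (c (x i) * c (y j)) = c (x i) * ∑ j, D i j * c (y j) := by
              rw [Finset.mul_sum]
              exact Finset.sum_congr rfl fun j _ => by ring
          _ = 0 := by rw [h1, mul_zero]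
      rw [Finset.filter_true_of_mem fun x _ => hall x, Finset.card_univ, ← hQ]
      obtain ⟨p', rfl⟩ : ∃ p', p = p' + 1 := ⟨p - 1, by have := hp.pos; lia⟩
      rw [Nat.add_sub_cancel]
      exact le_of_eq (by ring)
    · rw [add_zero, mul_comm]
      refine card_le_card_fiber_zero_mul (f y) ?_
      exact (Nat.card_mono (Set.toFinite _) (Set.subset_univ _)).trans (by simp)
  have hsum := Finset.sum_le_sum fun y (_ : y ∈ Finset.univ) => hy y
  rw [← Finset.mul_sum, ← hcount, Finset.sum_add_distrib, ← Finset.sum_filter, Finset.sum_const,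
    Finset.sum_const, Finset.card_univ, ← hQ, smul_eq_mul, smul_eq_mul] at hsum
  rw [hcardF]
  set N₀ := (Finset.univ.filter fun F : Fin n → Fin 2 → ZMod m =>
        ∑ i, ∑ j, D i j * (c (F i 0) * c (F j 1)) = 0).card
  calc (p ^ B + (p - 1)) * (Q * Q) = p ^ B * (Q * Q) + Q * ((p - 1) * Q) := by ring
    _ ≤ p ^ B * (Q * Q) + ((Finset.univ.filter fun y => k y = 0).card * p ^ B) * ((p - 1) * Q) := by
        gcongr
    _ = p ^ B * (Q * Q + (Finset.univ.filter fun y => k y = 0).card * ((p - 1) * Q)) := by ring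
    _ ≤ p ^ B * (p * N₀) := by gcongr
    _ = p * p ^ B * N₀ := by ring

/-- If `C / h mod p` vanishes at `(x, y)`, then `C` vanishes at `(x, y)` modulo `h * p`. -/
theorem sum_castHom_mul_eq_zero {a h p n : ℕ} [NeZero a] (hha : h ∣ a) (hma : h * p ∣ a)
    {C : Matrix (Fin n) (Fin n) (ZMod a)} (hC : ∀ i j, (h : ZMod a) ∣ C i j)
    {F : Fin n → Fin 2 → ZMod (h * p)}
    (hF : ∑ i, ∑ j, divModMatrix h p C i j *
      (ZMod.castHom (dvd_mul_left p h) (ZMod p) (F i 0) *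
        ZMod.castHom (dvd_mul_left p h) (ZMod p) (F j 1)) = 0) :
    ∑ i, ∑ j, C.map (ZMod.castHom hma (ZMod (h * p))) i j * (F i 0 * F j 1) = 0 := by
  have : NeZero (h * p) := ⟨fun h0 => NeZero.ne a (Nat.eq_zero_of_zero_dvd (h0 ▸ hma))⟩
  have hval : ∀ i j, C.map (ZMod.castHom hma (ZMod (h * p))) i j =
      (h : ZMod (h * p)) * (((C i j).val / h : ℕ) : ZMod (h * p)) := by
    intro i j
    obtain ⟨d, hd⟩ := hC i j
    have hdvd : h ∣ (C i j).val := by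
      have h1 : C i j = ((h * d.val : ℕ) : ZMod a) := by
        rw [hd, Nat.cast_mul, ZMod.natCast_zmod_val]
      rw [h1, ZMod.val_natCast]
      exact (Nat.dvd_mod_iff hha).2 (dvd_mul_right _ _)
    rw [← Nat.cast_mul, Nat.mul_div_cancel' hdvd, Matrix.map_apply]
    conv_lhs => rw [← ZMod.natCast_zmod_val (C i j)]
    rw [map_natCast]
  -- Multiplication by h on ℤ/hp factors through reduction mod p.
  have hker : ∀ z : ZMod (h * p), ZMod.castHom (dvd_mul_left p h) (ZMod p) z = 0 →
      (h : ZMod (h * p)) * z = 0 := by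
    intro z hz
    rw [← ZMod.natCast_zmod_val z, map_natCast, ZMod.natCast_eq_zero_iff] at hz
    rw [← ZMod.natCast_zmod_val z, ← Nat.cast_mul, ZMod.natCast_eq_zero_iff]
    exact Nat.mul_dvd_mul_left h hz
  simp only [hval, mul_assoc, ← Finset.mul_sum]
  refine hker _ ?_
  rw [← hF]
  simp only [map_sum, map_mul, map_natCast, divModMatrix, Matrix.map_apply]

/-! ### The exterior square of the h-torsion -/

/-- The h-torsion is generated by p times the two basis vectors, so its exterior square is cyclic,
generated by their wedge, which h kills. An upper bound is all that is needed. -/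
theorem cardWedgeTwoTorsion_le {h p : ℕ} (hh : 0 < h) (hp : 0 < p) :
    cardWedgeTwoTorsion (Fin 2 → ZMod (h * p)) h ≤ h := by
  have : NeZero (h * p) := ⟨(Nat.mul_pos hh hp).ne'⟩
  have : NeZero h := ⟨hh.ne'⟩
  set T := Submodule.torsionBy ℤ (Fin 2 → ZMod (h * p)) (h : ℤ) with hT
  have hmem : ∀ k : Fin 2, (Pi.single k (p : ZMod (h * p)) : Fin 2 → ZMod (h * p)) ∈ T := by
    intro k
    rw [hT, Submodule.mem_torsionBy_iff, ← Pi.single_smul, zsmul_eq_mul, Int.cast_natCast,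
      ← Nat.cast_mul, ZMod.natCast_self, Pi.single_zero]
  let e (k : Fin 2) : T := ⟨Pi.single k p, hmem k⟩
  have hcoord : ∀ v : T, ∃ z : Fin 2 → ℤ, v = z 0 • e 0 + z 1 • e 1 := by
    intro v
    have hv : ∀ k, ∃ z : ℤ, v.1 k = z • (p : ZMod (h * p)) := by
      intro k
      have h1 := congrFun ((Submodule.mem_torsionBy_iff _ _).1 v.2) k
      rw [Pi.smul_apply, Pi.zero_apply, zsmul_eq_mul, Int.cast_natCast,
        ← ZMod.natCast_zmod_val (v.1 k), ← Nat.cast_mul, ZMod.natCast_eq_zero_iff] at h1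
      obtain ⟨d, hd⟩ := Nat.dvd_of_mul_dvd_mul_left hh h1
      refine ⟨d, ?_⟩
      rw [← ZMod.natCast_zmod_val (v.1 k), hd, zsmul_eq_mul]
      push_cast
      ring
    choose z hz using hv
    refine ⟨z, Subtype.ext (funext fun k => ?_)⟩
    rw [hz]
    fin_cases k <;> simp [e]
  set w := exteriorPower.ιMulti ℤ 2 e with hw
  have hwh : (h : ℤ) • w = 0 := by
    have h1 := (exteriorPower.ιMulti ℤ 2 (M := T)).map_update_smul e 0 (h : ℤ) (e 0)
    have h2 : (h : ℤ) • e 0 = 0 := Subtype.ext ((Submodule.mem_torsionBy_iff _ _).1 (hmem 0))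
    rw [h2, Function.update_eq_self] at h1
    rw [hw, ← h1]
    exact (exteriorPower.ιMulti ℤ 2 (M := T)).map_update_zero e 0
  have hspanT : Submodule.span ℤ (Set.range e) = ⊤ := by
    refine (Submodule.eq_top_iff').2 fun v => ?_
    obtain ⟨z, hz⟩ := hcoord v
    rw [hz]
    exact add_mem (Submodule.smul_mem _ _ (Submodule.subset_span ⟨0, rfl⟩))
      (Submodule.smul_mem _ _ (Submodule.subset_span ⟨1, rfl⟩))
  have hspan : ∀ x : ⋀[ℤ]^2 T, x ∈ AddSubgroup.zmultiples w := by
    intro x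
    have hx : x ∈ Submodule.span ℤ
        (exteriorPower.ιMulti ℤ 2 (M := T) '' {v | Set.range v ⊆ Set.range e}) := by
      rw [exteriorPower.ιMulti_span_of_span ℤ 2 T hspanT]; trivial
    rw [AddSubgroup.mem_zmultiples_iff, ← Submodule.mem_span_singleton]
    refine Submodule.span_le.2 ?_ hx
    rintro _ ⟨v, hv, rfl⟩
    have hvk : ∀ k, ∃ l, v k = e l := fun k => by
      obtain ⟨l, hl⟩ := hv ⟨k, rfl⟩
      exact ⟨l, hl.symm⟩
    choose l hl using hvk
    have hvl : v = e ∘ l := funext hl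
    rw [SetLike.mem_coe]
    by_cases h01 : l 0 = l 1
    · rw [(exteriorPower.ιMulti ℤ 2 (M := T)).map_eq_zero_of_eq v (i := 0) (j := 1)
        (by rw [hl, hl, h01]) (by decide)]
      exact Submodule.zero_mem _
    · have hl2 : l = id ∨ l = Equiv.swap 0 1 := by
        have : ∀ l : Fin 2 → Fin 2, l 0 ≠ l 1 → l = id ∨ l = Equiv.swap 0 1 := by decide
        exact this l h01
      rcases hl2 with h2 | h2
      · rw [hvl, h2]
        exact Submodule.mem_span_singleton_self _
      · rw [hvl, h2, (exteriorPower.ιMulti ℤ 2 (M := T)).map_swap e (by decide)]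
        exact Submodule.neg_mem _ (Submodule.mem_span_singleton_self _)
  have hle : Nat.card (⋀[ℤ]^2 T) = addOrderOf w := by
    rw [← Nat.card_zmultiples, (AddSubgroup.eq_top_iff' _).2 hspan]
    exact (Nat.card_congr (Equiv.Set.univ _)).symm
  rw [cardWedgeTwoTorsion, hle]
  refine Nat.le_of_dvd hh (addOrderOf_dvd_iff_nsmul_eq_zero.2 ?_)
  rw [← natCast_zsmul]
  exact hwh

/-! ### From annihilated tuples to moments -/

/-- Every tuple `F` of generators of `(ℤ/m)²` that is annihilated by `Y` gives a surjection from
the cokernel of `Y`. -/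
theorem card_le_numSur {a m n : ℕ} [NeZero a] [NeZero m] (c : ZMod a →+* ZMod m)
    (Y : Matrix (Fin n) (Fin n) (ZMod a)) (S : Finset (Fin n → Fin 2 → ZMod m))
    (hS : ∀ F ∈ S, Function.Surjective F) [DecidablePred fun F : Fin n → Fin 2 → ZMod m =>
      ∀ j, ∑ i, c (Y i j) • F i = 0] :
    (S.filter fun F => ∀ j, ∑ i, c (Y i j) • F i = 0).card ≤
      numSur (MatrixCoker Y) (Fin 2 → ZMod m) := by
  set S' := S.filter fun F => ∀ j, ∑ i, c (Y i j) • F i = 0 with hS'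
  let φ (F : Fin n → Fin 2 → ZMod m) : (Fin n → ZMod a) →ₛₗ[c] (Fin 2 → ZMod m) :=
    { toFun := fun v => ∑ i, c (v i) • F i
      map_add' := fun v w => by simp only [Pi.add_apply, map_add, add_smul, Finset.sum_add_distrib]
      map_smul' := fun r v => by
        simp only [Pi.smul_apply, smul_eq_mul, map_mul, mul_smul, Finset.smul_sum] }
  have hφ : ∀ F ∈ S', LinearMap.range Y.mulVecLin ≤ LinearMap.ker (φ F) := by
    rintro F hF _ ⟨x, rfl⟩
    rw [LinearMap.mem_ker]
    change ∑ i, c (∑ j, Y i j * x j) • F i = 0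
    have h1 : ∀ i, c (∑ j, Y i j * x j) • F i = ∑ j, c (x j) • c (Y i j) • F i := fun i => by
      rw [map_sum, Finset.sum_smul]
      exact Finset.sum_congr rfl fun j _ => by rw [map_mul, mul_comm, mul_smul]
    simp only [h1]
    rw [Finset.sum_comm]
    refine Finset.sum_eq_zero fun j _ => ?_
    rw [← Finset.smul_sum, (Finset.mem_filter.1 hF).2 j, smul_zero]
  have hsingle : ∀ F i, φ F (Pi.single i 1) = F i := by
    intro F i
    change ∑ k, c ((Pi.single i 1 : Fin n → ZMod a) k) • F k = F i
    rw [Finset.sum_eq_single i]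
    · simp
    · intro k _ hk
      rw [Pi.single_eq_of_ne hk, map_zero, zero_smul]
    · simp
  let ψ (F : S') : {f : MatrixCoker Y →+ (Fin 2 → ZMod m) // Function.Surjective f} :=
    ⟨((LinearMap.range Y.mulVecLin).liftQ (φ F.1) (hφ F.1 F.2)).toAddMonoidHom, fun g => by
      obtain ⟨i, hi⟩ := hS F.1 (Finset.mem_filter.1 F.2).1 g
      exact ⟨Submodule.Quotient.mk (Pi.single i 1), (hsingle F.1 i).trans hi⟩⟩
  have hψ : Function.Injective ψ := by
    intro F F' hFF
    refine Subtype.ext (funext fun i => ?_)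
    have h1 := DFunLike.congr_fun (congrArg Subtype.val hFF) (Submodule.Quotient.mk (Pi.single i 1))
    exact (hsingle F.1 i).symm.trans (h1.trans (hsingle F'.1 i))
  -- `Nat.card` of an infinite type is 0, so finiteness must be checked before comparing
  -- cardinalities.
  have hfin : Finite (MatrixCoker Y →+ (Fin 2 → ZMod m)) :=
    Finite.of_injective _ (DFunLike.coe_injective (F := MatrixCoker Y →+ (Fin 2 → ZMod m)))
  calc S'.card = Nat.card S' := by rw [Nat.card_eq_fintype_card, Fintype.card_coe]
    _ ≤ _ := Nat.card_le_card_of_injective ψ hψ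

theorem IsBalancedCSymmetric.le_cokerMoment {a m n : ℕ} [NeZero a] [NeZero m] (hma : m ∣ a)
    {Ω : Type*} [MeasurableSpace Ω] {μ : Measure Ω} [IsProbabilityMeasure μ] {ε : ℝ}
    {C : Matrix (Fin n) (Fin n) (ZMod a)} {X : Ω → Matrix (Fin n) (Fin n) (ZMod a)}
    (hX : IsBalancedCSymmetric μ ε C X) (S : Finset (Fin n → Fin 2 → ZMod m))
    (hS : ∀ F ∈ S, Function.Surjective F) {b : ℝ}
    (hb : ∀ F ∈ S, b ≤ μ.real {ω | ∀ j, ∑ i, ZMod.castHom hma (ZMod m) (X ω i j) • F i = 0}) :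
    ENNReal.ofReal (S.card * b) ≤ cokerMoment μ X (Fin 2 → ZMod m) := by
  classical
  set A : (Fin n → Fin 2 → ZMod m) → Set Ω := fun F =>
    {ω | ∀ j, ∑ i, ZMod.castHom hma (ZMod m) (X ω i j) • F i = 0} with hA
  calc ENNReal.ofReal (S.card * b) = ∑ _F ∈ S, ENNReal.ofReal b := by
        rw [ENNReal.ofReal_mul (Nat.cast_nonneg _), ENNReal.ofReal_natCast, Finset.sum_const,
          nsmul_eq_mul]
    _ ≤ ∑ F ∈ S, μ (A F) := by
        refine Finset.sum_le_sum fun F hF => ?_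
        rw [← ofReal_measureReal]
        exact ENNReal.ofReal_le_ofReal (hb F hF)
    _ = ∑ F ∈ S, ∫⁻ ω, (A F).indicator 1 ω ∂μ := by
        refine Finset.sum_congr rfl fun F _ => ?_
        rw [lintegral_indicator_one (hX.measurableSet_forall_sum_smul_eq_zero hma F)]
    _ = ∫⁻ ω, ∑ F ∈ S, (A F).indicator 1 ω ∂μ := by
        rw [lintegral_finsetSum]
        exact fun F _ =>
          measurable_one.indicator (hX.measurableSet_forall_sum_smul_eq_zero hma F)
    _ ≤ cokerMoment μ X (Fin 2 → ZMod m) := by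
        refine lintegral_mono fun ω => ?_
        refine le_trans (le_of_eq ?_) (Nat.cast_le.2 (card_le_numSur (ZMod.castHom hma (ZMod m)) (X ω) S hS))
        rw [Finset.card_filter, Nat.cast_sum]
        refine Finset.sum_congr rfl fun F _ => ?_
        simp only [Set.indicator_apply, hA, Set.mem_ofPred_eq, Pi.one_apply]
        split_ifs <;> simp

/-! ### The lower bound and the conclusion -/

theorem exists_eq_pow_of_pos_lt_one {ρ : ℝ} (h0 : 0 < ρ) (h1 : ρ < 1) {k : ℕ} (hk : k ≠ 0) :
    ∃ σ : ℝ, 0 ≤ σ ∧ σ < 1 ∧ ρ = σ ^ k :=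
  ⟨ρ ^ (k⁻¹ : ℝ), by positivity, Real.rpow_lt_one h0.le h1 (by positivity),
    (Real.rpow_inv_natCast_pow h0.le hk).symm⟩

/-- The moments of the cokernels at `(ℤ/hp)²` are asymptotically bounded below by
`h (1 + (p - 1) / p ^ B)`. -/
theorem lt_liminf_cokerMoment
    {a h p : ℕ} [NeZero a] (hha : h ∣ a) (hp : p.Prime) (hma : h * p ∣ a) {ε : ℝ} (hε : 0 < ε)
    (C : (n : ℕ) → Matrix (Fin n) (Fin n) (ZMod a)) (hCalt : ∀ n, IsAlternatingMatrix (C n))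
    (hCdvd : ∀ n i j, (h : ZMod a) ∣ C n i j)
    {Ω : ℕ → Type*} [∀ n, MeasurableSpace (Ω n)]
    (μ : (n : ℕ) → Measure (Ω n)) [∀ n, IsProbabilityMeasure (μ n)]
    (X : (n : ℕ) → Ω n → Matrix (Fin n) (Fin n) (ZMod a))
    (hX : ∀ n, IsBalancedCSymmetric (μ n) ε (C n) (X n))
    {B : ℕ} (hB : ∀ n, (divModMatrix h p (C n)).rank ≤ B) :
    (h : ℝ≥0∞) < liminf (fun n => cokerMoment (μ n) (X n) (Fin 2 → ZMod (h * p))) atTop := by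
  classical
  have hh : 0 < h := Nat.pos_of_dvd_of_pos hha (NeZero.pos a)
  have : NeZero (h * p) := ⟨(Nat.mul_pos hh hp.pos).ne'⟩
  obtain ⟨ρ, hρ0, hρ1, hρ⟩ := exists_norm_integral_stdAddChar_le hma hε
  obtain ⟨K, hK0, hK⟩ := exists_tendsto_card_infrequent (Fin 2 → ZMod (h * p))
  set M := Fintype.card (Fin 2 → ZMod (h * p)) with hM
  have hM0 : 0 < M := Fintype.card_pos
  set T := Fintype.card ((Fin 2 → ZMod (h * p)) → Fin 2 → ZMod (h * p))
  obtain ⟨σ, hσ0, hσ1, hσ⟩ := exists_eq_pow_of_pos_lt_one hρ0 hρ1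
    (k := 4 * (K * M) ^ 2) (by positivity)
  set err : ℕ → ℝ := fun n => (M * σ ^ n) ^ n + T * (σ ^ n * (1 + M * σ ^ n) ^ n) with herr
  have herr0 : Tendsto err atTop (𝓝 0) := tendsto_error_bound hσ0 hσ1 M T
  set Q : ℕ → ℝ := fun n => Fintype.card (Fin n → Fin 2 → ZMod (h * p)) with hQ
  have hQ0 : ∀ n, 0 < Q n := fun n => Nat.cast_pos.2 Fintype.card_pos
  set freq : (n : ℕ) → (Fin n → Fin 2 → ZMod (h * p)) → Prop := fun n F =>
    ∀ g, n ≤ K * (Finset.univ.filter fun i => F i = g).card with hfreq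
  set rare : ℕ → ℝ := fun n => ((Finset.univ.filter fun F => ¬ freq n F).card : ℝ) / Q n with hrare
  -- q is the guaranteed density of zeros of the form, and q * (h * p) = h (1 + (p - 1) / p^B).
  set q : ℝ := (p ^ B + (p - 1)) / (p * p ^ B) with hq
  have hpr : (0 : ℝ) < p := Nat.cast_pos.2 hp.pos
  have hlim : Tendsto (fun n => (q - rare n) * (((h * p : ℕ) : ℝ) - err n)) atTop
      (𝓝 (q * ((h * p : ℕ) : ℝ))) := by
    simpa using (hK.const_sub q).mul (herr0.const_sub ((h * p : ℕ) : ℝ))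
  have hgt : (h : ℝ) < q * ((h * p : ℕ) : ℝ) := by
    have h1 : q * ((h * p : ℕ) : ℝ) = h + h * ((p - 1) / p ^ B) := by
      rw [hq]; push_cast; field_simp
    have h2 : (1 : ℝ) < p := by exact_mod_cast hp.one_lt
    have h3 : (0 : ℝ) < h := Nat.cast_pos.2 hh
    have h4 : 0 < (h : ℝ) * ((p - 1) / p ^ B) := by
      have : (0 : ℝ) < p - 1 := by linarith
      positivity
    linarith
  -- An eventual bound passes to the liminf only weakly, so strictness is secured by an intermediate
  -- r.
  obtain ⟨r, hr1, hr2⟩ := exists_between hgt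
  have hev : ∀ᶠ n in atTop, ENNReal.ofReal r ≤
      cokerMoment (μ n) (X n) (Fin 2 → ZMod (h * p)) := by
    have hm0 : (0 : ℝ) < ((h * p : ℕ) : ℝ) := Nat.cast_pos.2 (NeZero.pos _)
    filter_upwards [hlim.eventually_const_lt hr2, herr0.eventually_lt_const hm0,
      eventually_ge_atTop 1] with n hn1 hn2 hn3
    set zeros := Finset.univ.filter fun F : Fin n → Fin 2 → ZMod (h * p) =>
      ∑ i, ∑ j, divModMatrix h p (C n) i j *
        (ZMod.castHom (dvd_mul_left p h) (ZMod p) (F i 0) *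
          ZMod.castHom (dvd_mul_left p h) (ZMod p) (F j 1)) = 0 with hzeros
    set S := zeros.filter fun F => freq n F with hS
    have hsurj : ∀ F ∈ S, Function.Surjective F := by
      intro F hF g
      have h1 := (Finset.mem_filter.1 hF).2 g
      have h2 : 0 < (Finset.univ.filter fun i => F i = g).card :=
        Nat.pos_of_mul_pos_left (hn3.trans h1)
      obtain ⟨i, hi⟩ := Finset.card_pos.1 h2
      exact ⟨i, (Finset.mem_filter.1 hi).2⟩
    have hprob : ∀ F ∈ S, (((h * p : ℕ) : ℝ) - err n) / Q n ≤ (μ n).real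
        {ω | ∀ j, ∑ i, ZMod.castHom hma (ZMod (h * p)) (X n ω i j) • F i = 0} := by
      intro F hF
      rw [div_le_iff₀' (hQ0 n)]
      refine le_trans ?_ ((hX n).le_card_mul_measureReal (hCalt n) hma (hρ (μ n)) (hsurj F hF)
        (sum_castHom_mul_eq_zero hha hma (hCdvd n)
          (Finset.mem_filter.1 (Finset.mem_filter.1 hF).1).2))
      exact sub_le_sub_left (sum_pow_crossSupport_le (Finset.mem_filter.1 hF).2 hσ0 hσ1.le hσ) _
    refine le_trans (ENNReal.ofReal_le_ofReal ?_) ((hX n).le_cokerMoment hma S hsurj hprob)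
    have hcard : q - rare n ≤ S.card / Q n := by
      have h1 := card_bilinear_zero_ge (m := h * p) hp (dvd_mul_left p h) _ (hB n)
      have h2 : zeros.card ≤ S.card + (Finset.univ.filter fun F => ¬ freq n F).card := by
        rw [← Finset.card_filter_add_card_filter_not (s := zeros) (fun F => freq n F)]
        exact Nat.add_le_add_left (Finset.card_le_card
          (Finset.filter_subset_filter _ (Finset.subset_univ _))) _
      have h3 : q * Q n ≤ zeros.card := by
        have h4 : (((p ^ B + (p - 1) : ℕ) * Fintype.card (Fin n → Fin 2 → ZMod (h * p)) : ℕ) : ℝ) ≤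
          ((p * p ^ B * zeros.card : ℕ) : ℝ) := Nat.cast_le.2 h1
        push_cast [Nat.cast_sub hp.one_le] at h4
        rw [hq, div_mul_eq_mul_div, div_le_iff₀' (by positivity)]
        simpa [hQ] using h4
      have h5 : (zeros.card : ℝ) ≤ S.card + (Finset.univ.filter fun F => ¬ freq n F).card := by
        exact_mod_cast h2
      rw [le_div_iff₀ (hQ0 n), sub_mul, hrare, div_mul_cancel₀ _ (hQ0 n).ne']
      linarith
    calc r ≤ (q - rare n) * (((h * p : ℕ) : ℝ) - err n) := hn1.le
      _ ≤ S.card / Q n * (((h * p : ℕ) : ℝ) - err n) :=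
        mul_le_mul_of_nonneg_right hcard (by linarith)
      _ = S.card * ((((h * p : ℕ) : ℝ) - err n) / Q n) := by ring
  refine lt_of_lt_of_le ?_ (le_liminf_of_le (by isBoundedDefault) hev)
  rw [← ENNReal.ofReal_natCast]
  exact (ENNReal.ofReal_lt_ofReal_iff_of_nonneg (Nat.cast_nonneg _)).2 hr1

theorem mainTheorem4
    (a : ℕ) (ha : 0 < a) (h : ℕ) (hha : h ∣ a) (p : ℕ) (hp : p.Prime) (hpa : p ∣ a / h)
    (ε : ℝ) (hε : 0 < ε)
    (C : (n : ℕ) → Matrix (Fin n) (Fin n) (ZMod a))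
    (hCalt : ∀ n, IsAlternatingMatrix (C n))
    (hCdvd : ∀ n i j, (h : ZMod a) ∣ C n i j)
    {Ω : ℕ → Type*} [∀ n, MeasurableSpace (Ω n)]
    (μ : (n : ℕ) → Measure (Ω n)) [∀ n, IsProbabilityMeasure (μ n)]
    (X : (n : ℕ) → Ω n → Matrix (Fin n) (Fin n) (ZMod a))
    (hX : ∀ n, IsBalancedCSymmetric (μ n) ε (C n) (X n))
    (hrank : ∃ B : ℕ, ∀ n, (divModMatrix h p (C n)).rank ≤ B) :
    (cardWedgeTwoTorsion (Fin 2 → ZMod (h * p)) h : ℝ≥0∞) <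
        liminf (fun n => cokerMoment (μ n) (X n) (Fin 2 → ZMod (h * p))) atTop ∧
      ¬ ∀ (G : Type) [AddCommGroup G] [Finite G], AddMonoid.exponent G ∣ a →
        Tendsto (fun n => cokerMoment (μ n) (X n) G) atTop
          (𝓝 (cardWedgeTwoTorsion G h : ℝ≥0∞)) := by
  have : NeZero a := ⟨ha.ne'⟩
  have hh : 0 < h := Nat.pos_of_dvd_of_pos hha ha
  have hma : h * p ∣ a := by
    obtain ⟨b, rfl⟩ := hha
    rw [Nat.mul_div_cancel_left b hh] at hpa
    exact Nat.mul_dvd_mul_left h hpa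
  have hwedge : (cardWedgeTwoTorsion (Fin 2 → ZMod (h * p)) h : ℝ≥0∞) ≤ h :=
    Nat.cast_le.2 (cardWedgeTwoTorsion_le hh hp.pos)
  obtain ⟨B, hB⟩ := hrank
  have hlt := hwedge.trans_lt
    (lt_liminf_cokerMoment hha hp hma hε C hCalt hCdvd μ X hX hB)
  refine ⟨hlt, fun hall => ?_⟩
  have : NeZero (h * p) := ⟨(Nat.mul_pos hh hp.pos).ne'⟩
  have hexp : AddMonoid.exponent (Fin 2 → ZMod (h * p)) ∣ a := by
    refine (AddMonoid.exponent_dvd_of_forall_nsmul_eq_zero fun g => ?_).trans hma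
    ext k
    simp
  exact hlt.ne' (hall (Fin 2 → ZMod (h * p)) hexp).liminf_eq
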